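/- Let $G$ be a finite Abelian group with character group $\hat G=\mathrm{Hom}(G,U(1))$. The anyons of the 2d $G$ quantum double are the pairs $(m,\chi)\in G\times\hat G$ (flux, charge), with exchange phase $\theta(m,\chi)=\chi(m)$ and mutual braiding $B((m,\chi),(m',\chi'))=\chi(m')\chi'(m)$. A gapped domain wall of the quantum double is described by the set $W$ of pairs $(\alpha,\beta)$ such that the anyon $\alpha$, coming from the left, can leave as $\beta$ to the right: a Lagrangian subgroup $W\le (G\times\hat G)^2$, i.e. $\theta(\alpha)=\theta(\beta)$ on $W$, and $W$ contains every $(\alpha,\beta)$ with $B(\alpha,\alpha')=B(\beta,\beta')$ for all $(\alpha',\beta')\in W$. It is invertible if every anyon, from either side, can pass through it. A braided autoequivalence is a group automorphism $\varphi$ of $G\times\hat G$ with $\theta\circ\varphi=\theta$. SPT-sewing: take two disconnected square lattices, filling a left and a right half-plane and facing each other along their boundary columns, and a line between these columns. Put $G$-valued degrees of freedom on all vertices, in the trivial symmetric state $\sum_{g\in G}|g\rangle$ off the defect line (the two columns and the middle line); on the defect line, where each height $y\in\mathbb Z$ carries $\phi_y\in G\times G\times G$, put the 1d SPT of a 2-cocycle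 $\nu$ of $G\times G\times G$ with values in $U(1)$, obtained from the trivial state by the phases $\prod_y\nu(\phi_y,\phi_y^{-1}\phi_{y+1})$. Then apply the gauging map $|\phi\rangle\mapsto|d\phi\rangle$, $(d\phi)_{u\to v}=\phi_u^{-1}\phi_v$, on the three lattices. The resulting Hamiltonian consists of the vertex and plaquette terms of the two $G$ quantum doubles and of the gauged SPT terms on the defect line. An anyon $\alpha$ at a site $s$ of the left bulk passes through this wall as $\beta$ at a site $t$ of the right bulk if some invertible operator acting on finitely many edges creates $\alpha$ at $s$ and the antiparticle of $\beta$ at $t$, and no other excitation. Theorem. Every invertible gapped domain wall of the $G$ quantum double can be obtained by SPT-sewing with $G\times G\times G$ symmetry: for every invertible gapped domain wall $W$ there is a 2-cocycle $\nu: (G\times G\times G)^2\to U(1)$ such that, for all sites $s$ and $t$ and all anyons $\alpha,\beta$, the anyon $\alpha$ at $s$ passes through the wall sewn with $\nu$ as $\beta$ at $t$ if and only if $(\alpha,\beta)\in W$. Equivalently, for every braided autoequivalence $\varphi$ of $G\times\hat G$ there is a 2-cocycle $\nu$ of $G\times G\times G$ such that, for all sites and all anyons, $\alpha$ passes through the wall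 sewn with $\nu$ as $\beta$ if and only if $\beta=\varphi(\alpha)$. -/

import Mathlib

namespace SPTSewing

universe u

/-! ## The lattice

Two disconnected half-infinite square lattices, a left one with vertices `(-n, y)` and a right one
with vertices `(n, y)` (`n ≥ 0`, `y ∈ ℤ`), facing each other along their columns `n = 0`, and an
additional one-dimensional line between them.  The left lattice, the line and the right lattice
carry the first, second and third copy of the symmetry group. -/

/-- Vertices: `left n y` is at `(-n, y)`, `mid y` is on the middle line, `right n y` at `(n, y)`. -/
inductive Vertex
  | left (n : ℕ) (y : ℤ)
  | mid (y : ℤ)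
  | right (n : ℕ) (y : ℤ)
  deriving DecidableEq

/-- Oriented edges: horizontal edges point to the right, vertical edges point upwards. -/
inductive Edge
  | leftH (n : ℕ) (y : ℤ)
  | leftV (n : ℕ) (y : ℤ)
  | midV (y : ℤ)
  | rightH (n : ℕ) (y : ℤ)
  | rightV (n : ℕ) (y : ℤ)
  deriving DecidableEq

/-- The starting vertex of an edge. -/
def Edge.src : Edge → Vertex
  | .leftH n y => .left (n + 1) y
  | .leftV n y => .left n y
  | .midV y => .mid y
  | .rightH n y => .right n y
  | .rightV n y => .right n y

/-- The end vertex of an edge. -/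
def Edge.tgt : Edge → Vertex
  | .leftH n y => .left n y
  | .leftV n y => .left n (y + 1)
  | .midV y => .mid (y + 1)
  | .rightH n y => .right (n + 1) y
  | .rightV n y => .right n (y + 1)

/-- Plaquettes: `left n y` has lower left corner `(-(n + 1), y)` in the left lattice and
`right n y` has lower left corner `(n, y)` in the right lattice. -/
inductive Plaquette
  | left (n : ℕ) (y : ℤ)
  | right (n : ℕ) (y : ℤ)
  deriving DecidableEq

/-- Vertices away from the defect line. -/
def Vertex.IsBulk : Vertex → Prop
  | .left n _ => n ≠ 0
  | .mid _ => False
  | .right n _ => n ≠ 0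

section Model

variable {G : Type u} [CommGroup G]

/-- The holonomy of a `G`-valued edge configuration around a plaquette, counterclockwise from its
lower left corner. -/
def holonomy (a : Edge → G) : Plaquette → G
  | .left n y =>
      a (.leftH n y) * a (.leftV n y) * (a (.leftH n (y + 1)))⁻¹ * (a (.leftV (n + 1) y))⁻¹
  | .right n y =>
      a (.rightH n y) * a (.rightV (n + 1) y) * (a (.rightH n (y + 1)))⁻¹ * (a (.rightV n y))⁻¹

/-! ## States and operators -/

/-- States of `G`-valued degrees of freedom on the set `I`: finite linear combinations of the
product basis states `|a⟩`, `a : I → G`. -/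
abbrev State (I : Type) (G : Type u) : Type u := (I → G) →₀ ℂ

/-- The operator `|a⟩ ↦ p(a) |f(a)⟩`. -/
noncomputable def monomialOp {I : Type} (p : (I → G) → Circle) (f : (I → G) → (I → G)) :
    Module.End ℂ (State I G) :=
  Finsupp.linearCombination ℂ (fun a => Finsupp.single (f a) (p a : ℂ))

/-- The generalized Pauli operator `X_e^g : |a_e⟩ ↦ |g a_e⟩`. -/
noncomputable def edgeX (e : Edge) (g : G) : Module.End ℂ (State Edge G) :=
  monomialOp (fun _ => 1) (fun a => Function.update a e (g * a e))

/-- The generalized Pauli operator `Z_e^χ : |a_e⟩ ↦ χ(a_e) |a_e⟩`. -/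
noncomputable def edgeZ (e : Edge) (χ : G →* Circle) : Module.End ℂ (State Edge G) :=
  monomialOp (fun a => χ (a e)) id

/-- The algebra of all local operators (those acting on finitely many edges). -/
noncomputable def localAlgebra (G : Type u) [CommGroup G] :
    Subalgebra ℂ (Module.End ℂ (State Edge G)) :=
  Algebra.adjoin ℂ ({T | ∃ e g, T = edgeX e g} ∪ {T | ∃ e χ, T = edgeZ e χ})

/-! ## The SPT on the defect line before gauging -/

/-- The `U(1)`-valued 2-cocycles of a group `H` (with trivial action). -/
def IsTwoCocycle {H : Type u} [Group H] (ν : H → H → Circle) : Prop :=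
  ∀ g h k : H, ν g h * ν (g * h) k = ν h k * ν g (h * k)

/-- The multiplication `φ_v ↦ φ_v g⁻¹` at the vertex `v`. -/
def shiftVertex (v : Vertex) (g : G) (φ : Vertex → G) : Vertex → G :=
  fun w => if w = v then φ w * g⁻¹ else φ w

/-- The term `L^g_{-,v}` of the trivial symmetric Hamiltonian, whose ground state is the product
of the states `∑_g |g⟩`. -/
noncomputable def leftMulOp (v : Vertex) (g : G) : Module.End ℂ (State Vertex G) :=
  monomialOp (fun _ => 1) (shiftVertex v g)

/-- The `G × G × G`-valued field on the defect line. -/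
def lineField (φ : Vertex → G) (y : ℤ) : G × G × G :=
  (φ (.left 0 y), φ (.mid y), φ (.right 0 y))

/-- The simultaneous multiplication by `g⁻¹` of the three degrees of freedom at height `y`. -/
def shiftLine (y : ℤ) (g : G × G × G) (φ : Vertex → G) : Vertex → G :=
  shiftVertex (.left 0 y) g.1 (shiftVertex (.mid y) g.2.1 (shiftVertex (.right 0 y) g.2.2 φ))

/-- The phase which the SPT entangler `U_ν` assigns to the link from height `y` to `y + 1`. -/
def linkPhase (ν : G × G × G → G × G × G → Circle) (φ : Vertex → G) (y : ℤ) : Circle :=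
  ν (lineField φ y) ((lineField φ y)⁻¹ * lineField φ (y + 1))

/-- The term `U_ν L^g_{-,y} U_ν†` of the 1d SPT Hamiltonian on the defect line.  Only the two
links that meet height `y` contribute to the phase. -/
noncomputable def sptOp (ν : G × G × G → G × G × G → Circle) (y : ℤ) (g : G × G × G) :
    Module.End ℂ (State Vertex G) :=
  monomialOp
    (fun φ => (linkPhase ν (shiftLine y g φ) (y - 1) * linkPhase ν (shiftLine y g φ) y) /
      (linkPhase ν φ (y - 1) * linkPhase ν φ y))
    (shiftLine y g)

/-! ## Gauging -/

/-- The edge configuration `(φ_u)⁻¹ φ_v` on the edges `u → v`. -/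
def differential (φ : Vertex → G) : Edge → G := fun e => (φ e.src)⁻¹ * φ e.tgt

/-- The gauging map `Γ |φ⟩ = |dφ⟩`. -/
noncomputable def gauging : State Vertex G →ₗ[ℂ] State Edge G :=
  Finsupp.lmapDomain ℂ ℂ differential

/-- The gauge transformation at the vertex `v`: `a_e ↦ g a_e` on outgoing edges and
`a_e ↦ a_e g⁻¹` on incoming edges. -/
def gaugeTransform (v : Vertex) (g : G) (a : Edge → G) : Edge → G :=
  fun e => (if e.src = v then g else 1) * a e * (if e.tgt = v then g⁻¹ else 1)

/-- The vertex operator `A_v^g` of the quantum double. -/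
noncomputable def starOp (v : Vertex) (g : G) : Module.End ℂ (State Edge G) :=
  monomialOp (fun _ => 1) (gaugeTransform v g)

/-- The plaquette operator `|a⟩ ↦ χ(hol_p(a)) |a⟩` of the quantum double; the projector onto zero
flux at `p` is the average of these operators over all characters `χ`. -/
noncomputable def fluxOp (p : Plaquette) (χ : G →* Circle) : Module.End ℂ (State Edge G) :=
  monomialOp (fun a => χ (holonomy a p)) id

/-- The simultaneous gauge transformation of the three layers at height `y`. -/
def gaugeTransformLine (y : ℤ) (g : G × G × G) (a : Edge → G) : Edge → G :=
  gaugeTransform (.left 0 y) g.1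
    (gaugeTransform (.mid y) g.2.1 (gaugeTransform (.right 0 y) g.2.2 a))

/-- The `G × G × G`-valued configuration on the edge of the defect line from `y` to `y + 1`. -/
def lineEdge (a : Edge → G) (y : ℤ) : G × G × G :=
  (a (.leftV 0 y), a (.midV y), a (.rightV 0 y))

/-- The gauged SPT term on the defect line at height `y` (see `gauging_sptOp`). -/
noncomputable def wallOp (ν : G × G × G → G × G × G → Circle) (y : ℤ) (g : G × G × G) :
    Module.End ℂ (State Edge G) :=
  monomialOp
    (fun a => ν (lineEdge a (y - 1) * g⁻¹) (g * lineEdge a y) /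
      ν (lineEdge a (y - 1)) (lineEdge a y))
    (gaugeTransformLine y g)

theorem differential_shiftVertex (v : Vertex) (g : G) (φ : Vertex → G) :
    differential (shiftVertex v g φ) = gaugeTransform v g (differential φ) := by
  funext e
  simp only [differential, shiftVertex, gaugeTransform]
  split_ifs
  · rw [mul_inv, inv_inv, mul_comm _ g]; group
  · rw [mul_inv, inv_inv, mul_comm _ g]; group
  · group
  · group

/-- Gauging turns `L^g_{-,v}` into `A_v^g`. -/
theorem gauging_leftMulOp (v : Vertex) (g : G) :
    gauging ∘ₗ leftMulOp v g = starOp v g ∘ₗ gauging := by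
  ext φ : 2
  simp [gauging, leftMulOp, starOp, monomialOp, Finsupp.mapDomain_single,
    differential_shiftVertex]

/-- Gauging produces zero-flux states. -/
theorem fluxOp_gauging (p : Plaquette) (χ : G →* Circle) :
    fluxOp p χ ∘ₗ gauging = gauging (G := G) := by
  ext φ : 2
  have h : holonomy (differential φ) p = 1 := by
    cases p <;> simp only [holonomy, differential, Edge.src, Edge.tgt] <;> group
  simp [gauging, fluxOp, monomialOp, Finsupp.mapDomain_single, h]

theorem lineField_shiftLine_self (y : ℤ) (g : G × G × G) (φ : Vertex → G) :
    lineField (shiftLine y g φ) y = lineField φ y * g⁻¹ := by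
  ext <;> simp [lineField, shiftLine, shiftVertex]

theorem lineField_shiftLine_ne {y z : ℤ} (h : z ≠ y) (g : G × G × G) (φ : Vertex → G) :
    lineField (shiftLine y g φ) z = lineField φ z := by
  ext <;> simp [lineField, shiftLine, shiftVertex, h]

theorem lineEdge_differential (φ : Vertex → G) (y : ℤ) :
    lineEdge (differential φ) y = (lineField φ y)⁻¹ * lineField φ (y + 1) := rfl

/-- Gauging turns the SPT term `U_ν L^g_{-,y} U_ν†` into the domain wall term `wallOp ν y g`. -/
theorem gauging_sptOp {ν : G × G × G → G × G × G → Circle} (hν : IsTwoCocycle ν)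
    (y : ℤ) (g : G × G × G) :
    gauging ∘ₗ sptOp ν y g = wallOp ν y g ∘ₗ gauging := by
  ext φ : 2
  have hd : differential (shiftLine y g φ) = gaugeTransformLine y g (differential φ) := by
    simp [shiftLine, gaugeTransformLine, differential_shiftVertex]
  have e1 : y - 1 ≠ y := by omega
  have e2 : y + 1 ≠ y := by omega
  have key : (linkPhase ν (shiftLine y g φ) (y - 1) * linkPhase ν (shiftLine y g φ) y) /
      (linkPhase ν φ (y - 1) * linkPhase ν φ y) =
      ν (lineEdge (differential φ) (y - 1) * g⁻¹) (g * lineEdge (differential φ) y) /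
      ν (lineEdge (differential φ) (y - 1)) (lineEdge (differential φ) y) := by
    simp only [linkPhase, lineEdge_differential, sub_add_cancel, lineField_shiftLine_self,
      lineField_shiftLine_ne e1, lineField_shiftLine_ne e2]
    generalize lineField φ (y - 1) = a
    generalize lineField φ y = b
    generalize lineField φ (y + 1) = c
    have h1 := hν a (a⁻¹ * b) (b⁻¹ * c)
    have h2 := hν a (a⁻¹ * (b * g⁻¹)) ((b * g⁻¹)⁻¹ * c)
    have r1 : a * (a⁻¹ * b) = b := by group
    have r2 : a⁻¹ * b * (b⁻¹ * c) = a⁻¹ * c := by group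
    have r3 : a * (a⁻¹ * (b * g⁻¹)) = b * g⁻¹ := by group
    have r4 : a⁻¹ * (b * g⁻¹) * ((b * g⁻¹)⁻¹ * c) = a⁻¹ * c := by group
    have r5 : a⁻¹ * b * g⁻¹ = a⁻¹ * (b * g⁻¹) := by group
    have r6 : g * (b⁻¹ * c) = (b * g⁻¹)⁻¹ * c := by group
    rw [r1, r2] at h1
    rw [r3, r4] at h2
    rw [r5, r6, h1, h2, mul_div_mul_right_eq_div]
  simp only [gauging, sptOp, wallOp, monomialOp, LinearMap.comp_apply, Finsupp.lsingle_apply,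
    Finsupp.linearCombination_single, Finsupp.lmapDomain_apply, Finsupp.mapDomain_single, one_smul,
    hd, key]

/-! ## Anyons and their passage through the sewn domain wall -/

/-- The anyons of the `G` quantum double: pairs of a flux in `G` and a charge in the character
group of `G`.  Fusion is the group multiplication. -/
abbrev Anyon (G : Type u) [CommGroup G] : Type u := G × (G →* Circle)

/-- The exchange phase (topological spin) of an anyon. -/
noncomputable def spin (α : Anyon G) : Circle := α.2 α.1

/-- The mutual braiding phase of two anyons. -/
noncomputable def braiding (α β : Anyon G) : Circle := α.2 β.1 * β.2 α.1

/-- The operator `O` creates the charge `c v` at every bulk vertex `v` and the flux `f p` at every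
plaquette `p`, and creates no excitation on the domain wall obtained by gauging the SPT `ν`. -/
def Creates (ν : G × G × G → G × G × G → Circle) (O : Module.End ℂ (State Edge G))
    (c : Vertex → (G →* Circle)) (f : Plaquette → G) : Prop :=
  (∀ v : Vertex, v.IsBulk → ∀ g : G, starOp v g * O = (c v g : ℂ) • (O * starOp v g)) ∧
  (∀ (p : Plaquette) (χ : G →* Circle), fluxOp p χ * O = (χ (f p) : ℂ) • (O * fluxOp p χ)) ∧
  (∀ (y : ℤ) (g : G × G × G), wallOp ν y g * O = O * wallOp ν y g)

/-- The anyon `α`, at the site `s` of the left bulk, passes through the domain wall sewn with `ν`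
and becomes the anyon `β`, at the site `t` of the right bulk: some invertible local operator creates
`α` at `s` together with the antiparticle of `β` at `t`, and no other excitation.  The site `(n, y)`
consists of the bulk vertex `(∓(n + 1), y)` and of the plaquette to its upper right. -/
def Passes (ν : G × G × G → G × G × G → Circle) (s t : ℕ × ℤ) (α β : Anyon G) : Prop :=
  ∃ O ∈ localAlgebra G, IsUnit O ∧
    Creates ν O
      (Pi.mulSingle (Vertex.left (s.1 + 1) s.2) α.2 *
        Pi.mulSingle (Vertex.right (t.1 + 1) t.2) (β⁻¹).2)
      (Pi.mulSingle (Plaquette.left s.1 s.2) α.1 *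
        Pi.mulSingle (Plaquette.right (t.1 + 1) t.2) (β⁻¹).1)

/-! ## Gapped domain walls -/

/-- A gapped domain wall between two copies of the `G` quantum double, given by the pairs `(α, β)`
such that `α` coming from the left can leave as `β` to the right: a Lagrangian subgroup of the
folded theory. -/
def IsGappedWall (W : Subgroup (Anyon G × Anyon G)) : Prop :=
  (∀ x ∈ W, spin x.1 = spin x.2) ∧
  (∀ x : Anyon G × Anyon G, (∀ z ∈ W, braiding x.1 z.1 = braiding x.2 z.2) → x ∈ W)

/-- A domain wall is invertible if all anyons can pass through it, from either side. -/
def IsInvertibleWall (W : Subgroup (Anyon G × Anyon G)) : Prop :=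
  (∀ α, ∃ β, (α, β) ∈ W) ∧ (∀ β, ∃ α, (α, β) ∈ W)

/-- Braided autoequivalences: automorphisms of the anyon group that preserve the exchange phases
(hence also all braiding phases). -/
def IsBraidedAutoequivalence (φ : Anyon G ≃* Anyon G) : Prop :=
  ∀ α, spin (φ α) = spin α

end Model

end SPTSewing

/-!
Sewing with a bicharacter `ν` of `G × G × G` gives a model all of whose terms are multiples of Pauli
operators `|a⟩ ↦ κ(a) |h a⟩`.  Pauli operators commute up to phases and are linearly independent, so
whenever some nonzero local operator creates given excitations, each Pauli operator in its expansion
creates the same ones (`exists_pairCreates_of_creates`).  What can pass through the wall is thus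
decided by equations for one pair `(h, κ)`.

These equations can be solved exactly when two conservation laws hold.  Multiplying all of them over
a large region, everything cancels except the total fluxes and charges on both sides and the phases
that the fluxes pick up on the defect line, which add up to the commutator
`Ω(x, y) = ν(x, y) / ν(y, x)` (`exists_of_pairCreates`); conversely, when the
total charges match, straight strings from the sites to the wall and a string along the wall solve
the equations (`exists_pairCreates`).  The result is
`passes_bicharacter_iff`: the anyon `(m, χ)` passes as `(m', χ')` if and only if there is a flux `b`
on the middle line with `Ω((m, b, m'), ·) = χ ⊗ 1 ⊗ χ'⁻¹`.

It remains to find, for a braided autoequivalence `φ`, an alternating bicharacter `Ω` for which this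
relation is the graph of `φ`.  An explicit choice, in which the middle copy of `G` plays the role of
the character group and enforces the relation between `m`, `m'` and `χ`, is made in
`exists_bicharacter_of_isBraidedAutoequivalence`.  Every alternating bicharacter of a finite abelian
group is a commutator `ν / νᵀ` (`exists_bicharacter_of_alternating`), and bicharacters are
2-cocycles.  Finally, an invertible Lagrangian subgroup is the graph of a braided
autoequivalence because the braiding is nondegenerate (`exists_braidedAutoequivalence_of_wall`).
-/

namespace SPTSewing

universe u

/-! ### Bicharacters of finite abelian groups -/

/-- A function of two variables that is multiplicative in each, as a homomorphism into the group of
homomorphisms. -/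
def bicharacter {H K A : Type*} [Group H] [Group K] [CommGroup A] (f : H → K → A)
    (hl : ∀ x y k, f (x * y) k = f x k * f y k) (hr : ∀ x k l, f x (k * l) = f x k * f x l) :
    H →* K →* A :=
  MonoidHom.mk' (fun x => MonoidHom.mk' (f x) (hr x)) fun x y => MonoidHom.ext (hl x y)

@[simp]
theorem bicharacter_apply {H K A : Type*} [Group H] [Group K] [CommGroup A] (f : H → K → A)
    (hl : ∀ x y k, f (x * y) k = f x k * f y k) (hr : ∀ x k l, f x (k * l) = f x k * f x l)
    (x : H) (k : K) : bicharacter f hl hr x k = f x k := rfl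

/-- Every alternating bicharacter `Ω` is the commutator of a bicharacter `ν`.  With respect to a
decomposition into cyclic groups, `ν` is the strictly upper triangular part of `Ω`: the diagonal
blocks of `Ω` vanish because an alternating bicharacter of a cyclic group is trivial. -/
theorem exists_bicharacter_of_alternating {H A : Type*} [CommGroup H] [Finite H] [CommGroup A]
    (Ω : H →* H →* A) (hΩ : ∀ x, Ω x x = 1) :
    ∃ ν : H →* H →* A, ∀ x y, Ω x y = ν x y / ν y x := by
  classical
  obtain ⟨ι, _, n, _, ⟨e⟩⟩ := CommGroup.equiv_prod_multiplicative_zmod_of_finite H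
  let P : ι → H →* H := fun i =>
    e.symm.toMonoidHom.comp ((MonoidHom.mulSingle _ i).comp ((Pi.evalMonoidHom _ i).comp
      e.toMonoidHom))
  have hP (x : H) : ∏ i, P i x = x := by
    have h : ∏ i, P i x = e.symm (∏ i, Pi.mulSingle i (e x i)) := by
      rw [map_prod]; rfl
    rw [h, Finset.univ_prod_mulSingle, MulEquiv.symm_apply_apply]
  have skew (x y : H) : Ω x y = (Ω y x)⁻¹ := by
    have h := hΩ (x * y)
    simp only [map_mul, MonoidHom.mul_apply, hΩ, one_mul, mul_one] at h
    exact eq_inv_of_mul_eq_one_left (by rw [← h, mul_comm])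
  have diag (i : ι) (x y : H) : Ω (P i x) (P i y) = 1 := by
    obtain ⟨g, hg⟩ := IsCyclic.exists_generator (α := Multiplicative (ZMod (n i)))
    obtain ⟨k, hk : g ^ k = e x i⟩ := hg (e x i)
    obtain ⟨l, hl : g ^ l = e y i⟩ := hg (e y i)
    have hx : P i x = (e.symm (Pi.mulSingle i g)) ^ k := by
      rw [← map_zpow, ← Pi.mulSingle_zpow, hk]; rfl
    have hy : P i y = (e.symm (Pi.mulSingle i g)) ^ l := by
      rw [← map_zpow, ← Pi.mulSingle_zpow, hl]; rfl
    rw [hx, hy, map_zpow, map_zpow, MonoidHom.zpow_apply, hΩ, one_zpow, one_zpow]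
  let r : ι → ℕ := fun i => Fintype.equivFin ι i
  have hr : Function.Injective r := Fin.val_injective.comp (Fintype.equivFin ι).injective
  refine ⟨bicharacter (fun x y => ∏ i, ∏ j, if r i < r j then Ω (P i x) (P j y) else 1) ?_ ?_, ?_⟩
  · intro x y k
    simp only [← Finset.prod_mul_distrib]
    refine Finset.prod_congr rfl fun i _ => Finset.prod_congr rfl fun j _ => ?_
    split_ifs <;> simp
  · intro x y k
    simp only [← Finset.prod_mul_distrib]
    refine Finset.prod_congr rfl fun i _ => Finset.prod_congr rfl fun j _ => ?_
    split_ifs <;> simp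
  · intro x y
    rw [bicharacter_apply, bicharacter_apply]
    rw [Finset.prod_comm (f := fun i j => if r i < r j then Ω (P i y) (P j x) else 1)]
    conv_lhs => rw [← hP x, ← hP y]
    simp only [map_prod, MonoidHom.finsetProd_apply, ← Finset.prod_div_distrib]
    rw [Finset.prod_comm]
    refine Finset.prod_congr rfl fun i _ => Finset.prod_congr rfl fun j _ => ?_
    rcases lt_trichotomy (r i) (r j) with h | h | h
    · simp [h, h.not_gt]
    · rw [hr h, diag]; simp
    · simp [h, h.not_gt, skew (P i x)]

/-- Bicharacters are 2-cocycles. -/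
theorem isTwoCocycle_bicharacter {H : Type*} [Group H] (ν : H →* H →* Circle) :
    IsTwoCocycle fun x y => ν x y := by
  intro g h k
  simp only [map_mul, MonoidHom.mul_apply]
  ac_rfl

/-! ### Anyons and braided autoequivalences -/

section

variable {G : Type u} [CommGroup G]

/-- The characters of a finite abelian group separate its elements. -/
theorem eq_one_of_forall_character [Finite G] {g : G} (h : ∀ χ : G →* Circle, χ g = 1) : g = 1 := by
  by_contra hg
  obtain ⟨χ, hχ⟩ := CommGroup.exists_apply_ne_one_of_hasEnoughRootsOfUnity G Circle hg
  exact hχ ((toUnits (G := Circle)).symm.injective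
    (by simpa using h ((toUnits (G := Circle)).symm.toMonoidHom.comp χ)))

/-- A finite abelian group is noncanonically isomorphic to its character group; only surjectivity is
needed below. -/
theorem exists_surjective_to_dual (G : Type*) [CommGroup G] [Finite G] :
    ∃ ι : G →* (G →* Circle), Function.Surjective ι := by
  obtain ⟨e⟩ := CommGroup.monoidHom_mulEquiv_of_hasEnoughRootsOfUnity G Circle
  let e' : (G →* Circle) ≃* G := (MulEquiv.monoidHomCongrRight (toUnits (G := Circle))).trans e
  exact ⟨e'.symm.toMonoidHom, e'.symm.surjective⟩

theorem spin_mul (α β : Anyon G) : spin (α * β) = spin α * spin β * braiding α β := by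
  simp only [spin, braiding, Prod.fst_mul, Prod.snd_mul, MonoidHom.mul_apply, map_mul]
  ac_rfl

/-- The braiding is nondegenerate. -/
theorem eq_of_forall_braiding_eq [Finite G] {α β : Anyon G}
    (h : ∀ γ, braiding α γ = braiding β γ) : α = β := by
  refine Prod.ext ?_ (MonoidHom.ext fun g => ?_)
  · rw [← div_eq_one]
    refine eq_one_of_forall_character fun χ => ?_
    have := h (1, χ)
    simp only [braiding, map_one, one_mul] at this
    rw [map_div, this, div_self']
  · simpa [braiding] using h (g, 1)

theorem IsBraidedAutoequivalence.braiding_map {φ : Anyon G ≃* Anyon G}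
    (hφ : IsBraidedAutoequivalence φ) (α β : Anyon G) :
    braiding (φ α) (φ β) = braiding α β := by
  have h := hφ (α * β)
  rw [map_mul, spin_mul, spin_mul, hφ, hφ] at h
  exact mul_left_cancel h

/-- An invertible gapped domain wall is the graph of a braided autoequivalence. -/
theorem exists_braidedAutoequivalence_of_wall [Finite G] {W : Subgroup (Anyon G × Anyon G)}
    (hW : IsGappedWall W) (hI : IsInvertibleWall W) :
    ∃ φ : Anyon G ≃* Anyon G, IsBraidedAutoequivalence φ ∧ ∀ α β, (α, β) ∈ W ↔ β = φ α := by
  have hB {x z : Anyon G × Anyon G} (hx : x ∈ W) (hz : z ∈ W) :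
      braiding x.1 z.1 = braiding x.2 z.2 := by
    have h := hW.1 _ (W.mul_mem hx hz)
    rw [Prod.fst_mul, Prod.snd_mul, spin_mul, spin_mul, hW.1 _ hx, hW.1 _ hz] at h
    exact mul_left_cancel h
  obtain ⟨φ, rfl⟩ := Subgroup.exists_mulEquiv_eq_graph (G := W)
    ⟨fun x y hxy => Subtype.ext (Prod.ext hxy (eq_of_forall_braiding_eq fun γ => by
        obtain ⟨δ, hδ⟩ := hI.2 γ
        have h1 := hB x.2 hδ
        have h2 := hB y.2 hδ
        have h3 : x.1.1 = y.1.1 := hxy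
        exact h1.symm.trans (h3 ▸ h2))),
      fun α => (hI.1 α).elim fun β h => ⟨⟨_, h⟩, rfl⟩⟩
    ⟨fun x y hxy => Subtype.ext (Prod.ext (eq_of_forall_braiding_eq fun γ => by
        obtain ⟨δ, hδ⟩ := hI.1 γ
        have h1 := hB x.2 hδ
        have h2 := hB y.2 hδ
        have h3 : x.1.2 = y.1.2 := hxy
        exact h1.trans (h3 ▸ h2.symm)) hxy),
      fun β => (hI.2 β).elim fun α h => ⟨⟨_, h⟩, rfl⟩⟩
  refine ⟨φ, fun α => (hW.1 (α, φ α) ?_).symm, fun α β => ?_⟩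
  · exact rfl
  · exact MonoidHom.mem_graph.trans eq_comm

/-- The block decomposition of an automorphism of the anyon group. -/
theorem exists_blocks (φ : Anyon G ≃* Anyon G) :
    ∃ (a : G →* G) (b : (G →* Circle) →* G) (c : G →* (G →* Circle))
      (d : (G →* Circle) →* (G →* Circle)), ∀ m χ, φ (m, χ) = (a m * b χ, c m * d χ) := by
  refine ⟨(MonoidHom.fst _ _).comp (φ.toMonoidHom.comp (MonoidHom.inl _ _)),
    (MonoidHom.fst _ _).comp (φ.toMonoidHom.comp (MonoidHom.inr _ _)),
    (MonoidHom.snd _ _).comp (φ.toMonoidHom.comp (MonoidHom.inl _ _)),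
    (MonoidHom.snd _ _).comp (φ.toMonoidHom.comp (MonoidHom.inr _ _)), fun m χ => ?_⟩
  have : ((m, χ) : Anyon G) = (m, 1) * (1, χ) := by simp
  rw [this, map_mul]
  rfl

/-- The algebraic core: an alternating bicharacter `Ω = ν / νᵀ` of `G × G × G` that encodes a
braided autoequivalence `φ`, in the sense of `passes_bicharacter_iff`.

Write `φ = (a b; c d)` in blocks, map the middle copy of `G` onto the character group by `ι`, and
put `n = m' / a m` for an element `(m, k, m')` with `ξ = ι k`.  Additively,
`Ω(x₁, x₂) = (c m₂)(n₁) + (d ξ₂)(n₁) + (d ξ₁)(b ξ₂) - (c m₁)(m₂') - (d ξ₁)(n₂)`.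
Since `φ` preserves exchange phases, `c m` is trivial on `a m` and `d ξ` on `b ξ`, so that `Ω` is
alternating.  The middle copy is a Lagrange multiplier: it imposes `(d ζ)(n - b ξ) = 0` for all `ζ`,
which stands in for the relation `m' = a m + b χ`, with `ξ = χ` as one of the solutions. -/
theorem exists_bicharacter_of_isBraidedAutoequivalence [Finite G] {φ : Anyon G ≃* Anyon G}
    (hφ : IsBraidedAutoequivalence φ) :
    ∃ ν : G × G × G →* G × G × G →* Circle, ∀ α β : Anyon G,
      (∃ b : G, ∀ g : G × G × G,
        ν (α.1, b, β.1) g / ν g (α.1, b, β.1) = α.2 g.1 / β.2 g.2.2) ↔ β = φ α := by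
  obtain ⟨ι, hι⟩ := exists_surjective_to_dual G
  obtain ⟨a, b, c, d, hdecomp⟩ := exists_blocks φ
  have hca (m : G) : c m (a m) = 1 := by
    simpa [spin, hdecomp] using hφ (m, 1)
  have hdb (χ : G →* Circle) : d χ (b χ) = 1 := by
    simpa [spin, hdecomp] using hφ (1, χ)
  have hcaca (m n : G) : c m (a n) * c n (a m) = 1 := by
    simpa [braiding, hdecomp] using hφ.braiding_map (m, 1) (n, 1)
  have hdbdb (χ η : G →* Circle) : d χ (b η) * d η (b χ) = 1 := by
    simpa [braiding, hdecomp] using hφ.braiding_map (1, χ) (1, η)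
  have hcbda (m : G) (η : G →* Circle) : c m (b η) * d η (a m) = η m := by
    simpa [braiding, hdecomp] using hφ.braiding_map (m, 1) (1, η)
  obtain ⟨Ω, Ω_apply⟩ : ∃ Ω : G × G × G →* G × G × G →* Circle, ∀ x y, Ω x y =
      c y.1 (x.2.2 / a x.1) * d (ι y.2.1) (x.2.2 / a x.1) * d (ι x.2.1) (b (ι y.2.1)) /
        (c x.1 y.2.2 * d (ι x.2.1) (y.2.2 / a y.1)) := by
    refine ⟨bicharacter (fun x y => c y.1 (x.2.2 / a x.1) * d (ι y.2.1) (x.2.2 / a x.1) *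
      d (ι x.2.1) (b (ι y.2.1)) / (c x.1 y.2.2 * d (ι x.2.1) (y.2.2 / a y.1))) ?_ ?_,
      fun x y => rfl⟩ <;> intro x y k <;>
      apply Additive.ofMul.injective <;>
      simp only [Prod.fst_mul, Prod.snd_mul, map_mul, map_div, MonoidHom.mul_apply, ofMul_mul,
        ofMul_div] <;>
      abel
  have hΩ (x : G × G × G) : Ω x x = 1 := by
    simp only [Ω_apply, hdb, map_div, hca]
    simp
  obtain ⟨ν, hν⟩ := exists_bicharacter_of_alternating Ω hΩ
  refine ⟨ν, ?_⟩
  rintro ⟨m, χ⟩ ⟨m', χ'⟩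
  simp only [← hν, Ω_apply]
  constructor
  · rintro ⟨k, hk⟩
    set ξ := ι k
    refine eq_of_forall_braiding_eq fun γ => ?_
    obtain ⟨γ, rfl⟩ := φ.surjective γ
    rw [hφ.braiding_map]
    obtain ⟨g, η⟩ := γ
    -- By nondegeneracy it suffices to braid with all `φ (g, η)`.  The hypothesis enters through its
    -- three components: the middle one at `ι l = η`, and the right one at the flux of `φ (g, η)`.
    have h1 := hk (g, 1, 1)
    have h2 (ζ : G →* Circle) : d ζ (m' / a m) * d ξ (b ζ) = 1 := by
      obtain ⟨l, rfl⟩ := hι ζ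
      simpa using hk (1, l, 1)
    have h4 := h2 η
    have h5 := hk (1, 1, a g * b η)
    have i1 := hcaca m g
    have i3 := hcbda m η
    simp only [hdecomp, braiding, map_one, MonoidHom.one_apply, one_mul, mul_one, div_one, one_div,
      map_div, map_mul, map_inv, MonoidHom.mul_apply] at h1 h4 h5 ⊢
    apply Additive.ofMul.injective
    apply_fun Additive.ofMul at h1 h4 h5 i1 i3
    simp only [ofMul_mul, ofMul_div, ofMul_inv, ofMul_one] at h1 h4 h5 i1 i3 ⊢
    linear_combination (norm := module) h1 + h4 + h5 + i1 + i3
  · rintro h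
    rw [hdecomp, Prod.mk.injEq] at h
    obtain ⟨rfl, rfl⟩ := h
    obtain ⟨k, hk⟩ := hι χ
    -- The charge itself solves the constraint imposed by the middle copy.
    refine ⟨k, ?_⟩
    rintro ⟨g, l, x⟩
    have i0 := hdbdb (ι l) χ
    have i1 := hcaca m g
    have i3 := hcbda g χ
    simp only [hk, mul_div_cancel_left, map_div, MonoidHom.mul_apply]
    apply Additive.ofMul.injective
    apply_fun Additive.ofMul at i0 i1 i3
    simp only [ofMul_mul, ofMul_div, ofMul_one] at i0 i1 i3 ⊢
    linear_combination (norm := module) i0 + i3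

/-! ### Pauli operators -/

/-- The Pauli operator `|a⟩ ↦ κ(a) |h a⟩` of a pair `(h, κ)` of an edge configuration `h` and a
character `κ` of the group of all edge configurations. -/
noncomputable def pauli (x : (Edge → G) × ((Edge → G) →* Circle)) :
    Module.End ℂ (State Edge G) :=
  monomialOp (fun a => x.2 a) (fun a => x.1 * a)

theorem pauli_single (x : (Edge → G) × ((Edge → G) →* Circle)) (a : Edge → G) (z : ℂ) :
    pauli x (Finsupp.single a z) = Finsupp.single (x.1 * a) (z * (x.2 a : ℂ)) := by
  simp [pauli, monomialOp, Finsupp.linearCombination_single]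

theorem pauli_mul (x y : (Edge → G) × ((Edge → G) →* Circle)) :
    pauli x * pauli y = (x.2 y.1 : ℂ) • pauli (x * y) := by
  ext a : 2
  simp only [LinearMap.comp_apply, Finsupp.lsingle_apply, Module.End.mul_apply, pauli_single,
    LinearMap.smul_apply, Finsupp.smul_single, map_mul, Circle.coe_mul, Prod.fst_mul, Prod.snd_mul,
    MonoidHom.mul_apply, smul_eq_mul, mul_assoc]
  congr 1
  ring

theorem pauli_one : pauli (1 : (Edge → G) × ((Edge → G) →* Circle)) = 1 := by
  ext a : 2
  simp [pauli_single]

theorem isUnit_pauli (x : (Edge → G) × ((Edge → G) →* Circle)) : IsUnit (pauli x) := by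
  refine isUnit_iff_exists.2 ⟨(x.2 x.1 : ℂ) • pauli x⁻¹, ?_, ?_⟩
  · rw [mul_smul_comm, pauli_mul, mul_inv_cancel, pauli_one, smul_smul, Prod.fst_inv, map_inv,
      ← Circle.coe_mul, mul_inv_cancel, Circle.coe_one, one_smul]
  · rw [smul_mul_assoc, pauli_mul, inv_mul_cancel, pauli_one, smul_smul, Prod.snd_inv,
      MonoidHom.inv_apply, ← Circle.coe_mul, mul_inv_cancel, Circle.coe_one, one_smul]

/-- Two Pauli operators commute up to the phase by which their characters detect the shifts. -/
theorem pauli_comm_iff (x y : (Edge → G) × ((Edge → G) →* Circle)) (μ : Circle) :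
    pauli x * pauli y = (μ : ℂ) • (pauli y * pauli x) ↔ x.2 y.1 = μ * y.2 x.1 := by
  rw [pauli_mul, pauli_mul, smul_smul, mul_comm y x, ← Circle.coe_mul]
  refine ⟨fun h => ?_, fun h => by rw [h]⟩
  have h1 := DFunLike.congr_fun (LinearMap.congr_fun h (Finsupp.single 1 1)) ((x * y).1 * 1)
  simp only [LinearMap.smul_apply, Finsupp.smul_apply, pauli_single, Finsupp.single_eq_same,
    map_one, Circle.coe_one, mul_one, smul_eq_mul] at h1
  exact Circle.coe_injective h1

/-- The linear independence of the characters of the group of edge configurations. -/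
theorem eq_zero_of_sum_character {f : ((Edge → G) →* Circle) →₀ ℂ}
    (hf : ∀ a : Edge → G, f.sum (fun κ z => z * (κ a : ℂ)) = 0) : f = 0 := by
  have hchar : LinearIndependent ℂ (fun (κ : (Edge → G) →* Circle) (a : Edge → G) => (κ a : ℂ)) :=
    (linearIndependent_monoidHom (Edge → G) ℂ).comp
      (fun κ : (Edge → G) →* Circle => Circle.coeHom.comp κ) fun κ κ' h =>
        MonoidHom.ext fun a => Circle.coe_injective (DFunLike.congr_fun h a)
  refine linearIndependent_iff.1 hchar f (funext fun a => ?_)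
  simpa [Finsupp.linearCombination_apply, Finsupp.sum] using hf a

/-- The matrix coefficients of a combination of Pauli operators. -/
theorem linearCombination_pauli_single_apply (l : (Edge → G) × ((Edge → G) →* Circle) →₀ ℂ)
    (h a : Edge → G) :
    Finsupp.linearCombination ℂ pauli l (Finsupp.single a 1) (h * a) =
      (l.curry h).sum fun κ z => z * (κ a : ℂ) := by
  classical
  have h1 : Finsupp.linearCombination ℂ pauli l (Finsupp.single a 1) (h * a) =
      l.sum (fun x z => if x.1 = h then z * (x.2 a : ℂ) else 0) := by
    rw [Finsupp.linearCombination_apply, Finsupp.sum, Finsupp.sum, LinearMap.sum_apply,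
      Finsupp.finsetSum_apply]
    refine Finset.sum_congr rfl fun x _ => ?_
    rw [LinearMap.smul_apply, pauli_single, Finsupp.smul_apply, Finsupp.single_apply]
    simp
  rw [h1, ← Finsupp.sum_curry_index l (fun k κ z => if k = h then z * (κ a : ℂ) else 0),
    Finsupp.sum, Finset.sum_eq_single h]
  · simp
  · intro k _ hk
    simp [hk, Finsupp.sum]
  · intro hh
    simp [Finsupp.notMem_support_iff.1 hh]

/-- The matrix coefficients of `pauli t * O` in terms of those of `O`. -/
theorem pauli_apply_mul (t : (Edge → G) × ((Edge → G) →* Circle)) (v : State Edge G)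
    (b : Edge → G) : pauli t v (t.1 * b) = t.2 b * v b := by
  classical
  induction v using Finsupp.induction_linear with
  | zero => simp
  | add v w hv hw => rw [map_add, Finsupp.add_apply, hv, hw, Finsupp.add_apply, mul_add]
  | single a z =>
    rw [pauli_single, Finsupp.single_apply, Finsupp.single_apply]
    simp only [mul_right_inj]
    split_ifs with hab
    · rw [hab, mul_comm]
    · rw [mul_zero]

/-- If a combination of Pauli operators commutes with a Pauli operator up to a phase, then so does
each of its terms. -/
theorem apply_eq_of_linearCombination_comm {t : (Edge → G) × ((Edge → G) →* Circle)} {μ : Circle}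
    {l : (Edge → G) × ((Edge → G) →* Circle) →₀ ℂ}
    (hl : pauli t * Finsupp.linearCombination ℂ pauli l =
      (μ : ℂ) • (Finsupp.linearCombination ℂ pauli l * pauli t))
    {x : (Edge → G) × ((Edge → G) →* Circle)} (hx : l x ≠ 0) : t.2 x.1 = μ * x.2 t.1 := by
  classical
  obtain ⟨h, κ⟩ := x
  -- For a fixed shift `h`, comparing matrix coefficients gives a relation between characters, whose
  -- coefficients vanish.
  let f : ((Edge → G) →* Circle) →₀ ℂ := Finsupp.onFinset (l.curry h).support
    (fun η => l (h, η) * ((t.2 h : ℂ) - μ * η t.1))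
      fun η hη => Finsupp.mem_support_iff.2 (left_ne_zero_of_mul hη)
  have hf : f = 0 := by
    refine eq_zero_of_sum_character fun a => ?_
    have h0 := DFunLike.congr_fun (LinearMap.congr_fun hl (Finsupp.single a 1)) (t.1 * (h * a))
    rw [Module.End.mul_apply, pauli_apply_mul, LinearMap.smul_apply, Module.End.mul_apply,
      pauli_single, one_mul, Finsupp.smul_apply, mul_left_comm, ← mul_one (t.2 a : ℂ),
      ← smul_eq_mul (t.2 a : ℂ), ← Finsupp.smul_single, map_smul, Finsupp.smul_apply,
      linearCombination_pauli_single_apply, linearCombination_pauli_single_apply, map_mul,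
      Circle.coe_mul, smul_eq_mul, smul_eq_mul, mul_right_comm, mul_left_comm,
      mul_comm _ (t.2 a : ℂ), ← sub_eq_zero, ← mul_sub] at h0
    have h1 := (mul_eq_zero.1 h0).resolve_left (Circle.coe_ne_zero _)
    rw [Finsupp.onFinset_sum _ fun _ => by simp, ← h1, Finsupp.sum, Finsupp.sum, Finset.mul_sum,
      Finset.mul_sum, ← Finset.sum_sub_distrib]
    refine Finset.sum_congr rfl fun η _ => ?_
    rw [Finsupp.curry_apply, map_mul, Circle.coe_mul]
    ring
  have h2 := DFunLike.congr_fun hf κ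
  exact Circle.coe_injective (sub_eq_zero.1 ((mul_eq_zero.1 h2).resolve_left hx))

/-- The pair `(h, κ)` is supported on a finite set `S` of edges: `h` is trivial outside `S`, and `κ`
is trivial on the configurations that are trivial on `S`. -/
def IsLocalPair (x : (Edge → G) × ((Edge → G) →* Circle)) : Prop :=
  ∃ S : Finset Edge, (∀ e ∉ S, x.1 e = 1) ∧ ∀ a : Edge → G, (∀ e ∈ S, a e = 1) → x.2 a = 1

theorem IsLocalPair.mul {x y : (Edge → G) × ((Edge → G) →* Circle)} (hx : IsLocalPair x)
    (hy : IsLocalPair y) : IsLocalPair (x * y) := by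
  classical
  obtain ⟨S, h1, h2⟩ := hx
  obtain ⟨T, h3, h4⟩ := hy
  refine ⟨S ∪ T, fun e he => ?_, fun a ha => ?_⟩
  · rw [Finset.notMem_union] at he
    rw [Prod.fst_mul, Pi.mul_apply, h1 e he.1, h3 e he.2, one_mul]
  · rw [Prod.snd_mul, MonoidHom.mul_apply, h2 a fun e he => ha e (Finset.mem_union_left _ he),
      h4 a fun e he => ha e (Finset.mem_union_right _ he), one_mul]

theorem edgeX_eq_pauli (e : Edge) (g : G) : edgeX e g = pauli (Pi.mulSingle e g, 1) := by
  ext a : 2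
  have : Function.update a e (g * a e) = Pi.mulSingle e g * a := by
    funext e'
    by_cases h : e' = e
    · subst h; simp
    · simp [h]
  simp [edgeX, pauli_single, monomialOp, this]

theorem edgeZ_eq_pauli (e : Edge) (χ : G →* Circle) :
    edgeZ e χ = pauli (1, χ.comp (Pi.evalMonoidHom _ e)) := by
  ext a : 2
  simp [edgeZ, pauli_single, monomialOp]

/-- Local operators are combinations of Pauli operators with finite support, because products of
Pauli operators are multiples of Pauli operators. -/
theorem exists_linearCombination_of_mem_localAlgebra {O : Module.End ℂ (State Edge G)}
    (hO : O ∈ localAlgebra G) :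
    ∃ l : (Edge → G) × ((Edge → G) →* Circle) →₀ ℂ,
      (∀ x, l x ≠ 0 → IsLocalPair x) ∧ Finsupp.linearCombination ℂ pauli l = O := by
  have hspan : O ∈ Submodule.span ℂ
      (pauli '' {x : (Edge → G) × ((Edge → G) →* Circle) | IsLocalPair x}) := by
    rw [localAlgebra, ← Subalgebra.mem_toSubmodule, Algebra.adjoin_eq_span] at hO
    refine Submodule.span_le.2 (fun T hT => ?_) hO
    have : ∃ (z : ℂ) (x : (Edge → G) × ((Edge → G) →* Circle)),
        IsLocalPair x ∧ T = z • pauli x := by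
      induction hT using Submonoid.closure_induction with
      | mem T hT =>
        rcases hT with ⟨e, g, rfl⟩ | ⟨e, χ, rfl⟩
        · refine ⟨1, (Pi.mulSingle e g, 1), ⟨{e}, fun e' he => ?_, fun a _ => rfl⟩, ?_⟩
          · exact Pi.mulSingle_eq_of_ne (M := fun _ => G) (Finset.notMem_singleton.1 he) g
          · rw [edgeX_eq_pauli, one_smul]
        · refine ⟨1, (1, χ.comp (Pi.evalMonoidHom _ e)), ⟨{e}, fun e' he => rfl, fun a ha => ?_⟩,
            ?_⟩
          · simp [ha e (Finset.mem_singleton_self e)]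
          · rw [edgeZ_eq_pauli, one_smul]
      | one => exact ⟨1, 1, ⟨∅, fun _ _ => rfl, fun _ _ => rfl⟩, by rw [pauli_one, one_smul]⟩
      | mul T U _ _ hT hU =>
        obtain ⟨z, x, hx, rfl⟩ := hT
        obtain ⟨w, y, hy, rfl⟩ := hU
        exact ⟨_, x * y, hx.mul hy, by rw [smul_mul_smul_comm, pauli_mul, smul_smul]⟩
    obtain ⟨z, x, hx, rfl⟩ := this
    exact Submodule.smul_mem _ _ (Submodule.subset_span ⟨x, hx, rfl⟩)
  obtain ⟨l, hl, rfl⟩ := (Finsupp.mem_span_image_iff_linearCombination ℂ).1 hspan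
  exact ⟨l, fun x hx => hl (Finsupp.mem_support_iff.2 hx), rfl⟩

/-- Pauli operators with finite support are products of the generators `edgeX` and `edgeZ`. -/
theorem pauli_mem_localAlgebra {x : (Edge → G) × ((Edge → G) →* Circle)} (hx : IsLocalPair x) :
    pauli x ∈ localAlgebra G := by
  classical
  obtain ⟨S, h1, h2⟩ := hx
  obtain ⟨h, κ⟩ := x
  have hX : pauli (h, 1) ∈ localAlgebra G := by
    have e : h = ∏ e ∈ S, Pi.mulSingle e (h e) := by
      funext e
      rw [Finset.prod_apply]
      by_cases he : e ∈ S
      · rw [Finset.prod_eq_single e (fun b _ hb => Pi.mulSingle_eq_of_ne hb.symm _)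
          fun h => (h he).elim, Pi.mulSingle_eq_same]
      · rw [Finset.prod_eq_one fun b hb => Pi.mulSingle_eq_of_ne (by rintro rfl; exact he hb) _]
        exact h1 e he
    rw [e]
    refine Finset.prod_induction _ (fun h => pauli (h, 1) ∈ localAlgebra G) (fun a b ha hb => ?_) ?_
      fun e _ => ?_
    · have := mul_mem ha hb
      rwa [pauli_mul, MonoidHom.one_apply, Circle.coe_one, one_smul, Prod.mk_mul_mk,
        one_mul] at this
    · exact pauli_one (G := G) ▸ one_mem _
    · exact edgeX_eq_pauli e (h e) ▸ Algebra.subset_adjoin (Or.inl ⟨e, h e, rfl⟩)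
  have hZ : pauli (1, κ) ∈ localAlgebra G := by
    have e : κ = ∏ e ∈ S, (κ.comp (MonoidHom.mulSingle _ e)).comp (Pi.evalMonoidHom _ e) := by
      ext1 a
      have ha : κ (a / ∏ e ∈ S, Pi.mulSingle e (a e)) = 1 := by
        refine h2 _ fun e he => ?_
        rw [Pi.div_apply, Finset.prod_apply,
          Finset.prod_eq_single e (fun b _ hb => Pi.mulSingle_eq_of_ne hb.symm _)
          fun h => (h he).elim, Pi.mulSingle_eq_same, div_self']
      rw [map_div, div_eq_one] at ha
      rw [ha, map_prod, MonoidHom.finsetProd_apply]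
      rfl
    rw [e]
    refine Finset.prod_induction _ (fun κ => pauli (1, κ) ∈ localAlgebra G)
      (fun a b ha hb => ?_) ?_ fun e _ => ?_
    · have := mul_mem ha hb
      rwa [pauli_mul, map_one, Circle.coe_one, one_smul, Prod.mk_mul_mk, one_mul] at this
    · exact pauli_one (G := G) ▸ one_mem _
    · exact edgeZ_eq_pauli e (κ.comp (MonoidHom.mulSingle _ e)) ▸
        Algebra.subset_adjoin (Or.inr ⟨e, _, rfl⟩)
  have := mul_mem hX hZ
  rwa [pauli_mul, MonoidHom.one_apply, Circle.coe_one, one_smul, Prod.mk_mul_mk, one_mul,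
    mul_one] at this

/-! ### Excitations created by Pauli operators -/

theorem gaugeTransform_eq_mul (v : Vertex) (g : G) (a : Edge → G) :
    gaugeTransform v g a = gaugeTransform v g 1 * a := by
  funext e
  simp only [gaugeTransform, Pi.mul_apply, Pi.one_apply, mul_one]
  exact mul_right_comm _ _ _

theorem gaugeTransformLine_eq_mul (y : ℤ) (g : G × G × G) (a : Edge → G) :
    gaugeTransformLine y g a = gaugeTransform (.left 0 y) g.1 1 *
      gaugeTransform (.mid y) g.2.1 1 * gaugeTransform (.right 0 y) g.2.2 1 * a := by
  rw [gaugeTransformLine, gaugeTransform_eq_mul, gaugeTransform_eq_mul (.mid y),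
    gaugeTransform_eq_mul (.right 0 y), mul_assoc, mul_assoc]

theorem starOp_eq_pauli (v : Vertex) (g : G) : starOp v g = pauli (gaugeTransform v g 1, 1) := by
  ext a : 2
  simp [starOp, pauli_single, monomialOp, ← gaugeTransform_eq_mul]

/-- The holonomy around a plaquette, as a homomorphism. -/
def holonomyHom (p : Plaquette) : (Edge → G) →* G :=
  MonoidHom.mk' (fun a => holonomy a p) fun a b => by
    cases p <;> simp only [holonomy, Pi.mul_apply, mul_inv] <;> ac_rfl

theorem fluxOp_eq_pauli (p : Plaquette) (χ : G →* Circle) :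
    fluxOp p χ = pauli (1, χ.comp (holonomyHom p)) := by
  ext a : 2
  simp [fluxOp, pauli_single, monomialOp, holonomyHom]

/-- The configuration on the edges of the defect line from height `y` to `y + 1`, as a
homomorphism. -/
def lineEdgeHom (y : ℤ) : (Edge → G) →* G × G × G :=
  MonoidHom.mk' (fun a => lineEdge a y) fun _ _ => rfl

theorem lineEdgeHom_apply (y : ℤ) (a : Edge → G) : lineEdgeHom y a = lineEdge a y := rfl

/-- For a bicharacter `ν` the domain wall term is a multiple of a Pauli operator. -/
theorem wallOp_eq_pauli (ν : G × G × G →* G × G × G →* Circle) (y : ℤ) (g : G × G × G) :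
    wallOp (fun a b => ν a b) y g = (((ν g g)⁻¹ : Circle) : ℂ) • pauli
      (gaugeTransform (.left 0 y) g.1 1 * gaugeTransform (.mid y) g.2.1 1 *
        gaugeTransform (.right 0 y) g.2.2 1,
        ((ν.flip g).comp (lineEdgeHom (y - 1))) / (ν g).comp (lineEdgeHom y)) := by
  ext a : 2
  have e : ν (lineEdge a (y - 1) * g⁻¹) (g * lineEdge a y) /
      ν (lineEdge a (y - 1)) (lineEdge a y) = (ν g g)⁻¹ *
        ((ν.flip g).comp (lineEdgeHom (y - 1)) / (ν g).comp (lineEdgeHom y)) a := by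
    simp only [map_mul, map_inv, MonoidHom.mul_apply, MonoidHom.inv_apply, MonoidHom.div_apply,
      MonoidHom.comp_apply, lineEdgeHom_apply, MonoidHom.flip_apply]
    apply Additive.ofMul.injective
    simp only [ofMul_mul, ofMul_div, ofMul_inv]
    abel
  simp only [wallOp, monomialOp, LinearMap.comp_apply, Finsupp.lsingle_apply,
    Finsupp.linearCombination_single, e]
  rw [LinearMap.smul_apply, pauli_single, ← gaugeTransformLine_eq_mul, one_smul, one_mul,
    Finsupp.smul_single, smul_eq_mul, ← Circle.coe_mul]

/-- The conditions on `(h, κ)` under which the Pauli operator `pauli (h, κ)` creates the charges `c`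
and the fluxes `f`, and no excitation on the domain wall (see `creates_pauli` and
`exists_pairCreates_of_creates`). -/
def PairCreates (ν : G × G × G →* G × G × G →* Circle) (x : (Edge → G) × ((Edge → G) →* Circle))
    (c : Vertex → (G →* Circle)) (f : Plaquette → G) : Prop :=
  (∀ v : Vertex, v.IsBulk → ∀ g : G, 1 = c v g * x.2 (gaugeTransform v g 1)) ∧
  (∀ p : Plaquette, holonomy x.1 p = f p) ∧
  ∀ (y : ℤ) (g : G × G × G), ν (lineEdge x.1 (y - 1)) g / ν g (lineEdge x.1 y) =
    x.2 (gaugeTransform (.left 0 y) g.1 1 * gaugeTransform (.mid y) g.2.1 1 *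
        gaugeTransform (.right 0 y) g.2.2 1)

theorem creates_pauli {ν : G × G × G →* G × G × G →* Circle}
    {x : (Edge → G) × ((Edge → G) →* Circle)} {c : Vertex → (G →* Circle)} {f : Plaquette → G}
    (hx : PairCreates ν x c f) : Creates (fun a b => ν a b) (pauli x) c f := by
  obtain ⟨h1, h2, h3⟩ := hx
  refine ⟨fun v hv g => ?_, fun p χ => ?_, fun y g => ?_⟩
  · rw [starOp_eq_pauli, pauli_comm_iff, MonoidHom.one_apply]
    exact h1 v hv g
  · rw [fluxOp_eq_pauli, pauli_comm_iff, map_one, mul_one]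
    exact congrArg χ (h2 p)
  · rw [wallOp_eq_pauli, smul_mul_assoc, mul_smul_comm]
    congr 1
    rw [← one_smul ℂ (pauli x * _), ← Circle.coe_one, pauli_comm_iff, one_mul]
    exact h3 y g

/-- If a nonzero local operator creates given excitations, then so does a Pauli operator with finite
support. -/
theorem exists_pairCreates_of_creates [Finite G] {ν : G × G × G →* G × G × G →* Circle}
    {O : Module.End ℂ (State Edge G)} (hO : O ∈ localAlgebra G) (h0 : O ≠ 0)
    {c : Vertex → (G →* Circle)} {f : Plaquette → G} (h : Creates (fun a b => ν a b) O c f) :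
    ∃ x, IsLocalPair x ∧ PairCreates ν x c f := by
  obtain ⟨l, hl, rfl⟩ := exists_linearCombination_of_mem_localAlgebra hO
  obtain ⟨x, hx⟩ : ∃ x, l x ≠ 0 := by
    by_contra! hc
    exact h0 (by rw [Finsupp.ext (g := 0) hc, map_zero])
  obtain ⟨h1, h2, h3⟩ := h
  refine ⟨x, hl x hx, fun v hv g => ?_, fun p => ?_, fun y g => ?_⟩
  · have := h1 v hv g
    rw [starOp_eq_pauli] at this
    simpa using apply_eq_of_linearCombination_comm this hx
  · rw [← div_eq_one]
    refine eq_one_of_forall_character fun χ => ?_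
    have := h2 p χ
    rw [fluxOp_eq_pauli] at this
    have := apply_eq_of_linearCombination_comm this hx
    rw [map_one, mul_one] at this
    rw [map_div, div_eq_one]
    exact this
  · have := h3 y g
    rw [wallOp_eq_pauli, smul_mul_assoc, mul_smul_comm] at this
    have := congrArg (fun T => (ν g g : ℂ) • T) this
    simp only [smul_smul, ← Circle.coe_mul, mul_inv_cancel, Circle.coe_one, one_smul] at this
    rw [← one_smul ℂ (Finsupp.linearCombination ℂ pauli l * _), ← Circle.coe_one] at this
    have := apply_eq_of_linearCombination_comm this hx
    rw [one_mul] at this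
    exact this

end

/-! ### Charge and flux conservation across the wall -/

theorem prod_Ico_div_succ {A : Type*} [CommGroup A] (F : ℤ → A) {M N : ℤ} (h : M ≤ N) :
    ∏ y ∈ Finset.Ico M N, F y / F (y + 1) = F M / F N := by
  induction N, h using Int.leInduction with
  | base => simp
  | succ n hn ih =>
    rw [← Finset.Ico_union_Ico_eq_Ico hn (by omega : n ≤ n + 1), Finset.prod_union
      (Finset.Ico_disjoint_Ico_consecutive _ _ _), ih,
      show Finset.Ico n (n + 1) = {n} by
        ext z; simp only [Finset.mem_Ico, Finset.mem_singleton]; omega]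
    simp

theorem prod_Ico_sub_one {A : Type*} [CommGroup A] (F : ℤ → A) {M N : ℤ} (h : M ≤ N)
    (hM : F (M - 1) = 1) (hN : F (N - 1) = 1) :
    ∏ y ∈ Finset.Ico M N, F (y - 1) = ∏ y ∈ Finset.Ico M N, F y := by
  have := prod_Ico_div_succ (fun y => F (y - 1)) h
  simp only [add_sub_cancel_right, hM, hN, div_one, Finset.prod_div_distrib] at this
  exact div_eq_one.1 this

/-- The height of a vertex. -/
def Vertex.height : Vertex → ℤ
  | .left _ y => y
  | .mid y => y
  | .right _ y => y

/-- A bound for the coordinates of an edge. -/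
def Edge.size : Edge → ℕ
  | .leftH n y => n + y.natAbs
  | .leftV n y => n + y.natAbs
  | .midV y => y.natAbs
  | .rightH n y => n + y.natAbs
  | .rightV n y => n + y.natAbs

theorem natAbs_height_src (e : Edge) : e.src.height.natAbs ≤ e.size := by
  cases e <;> simp only [Edge.src, Edge.size, Vertex.height] <;> omega

theorem natAbs_height_tgt (e : Edge) : e.tgt.height.natAbs ≤ e.size + 1 := by
  cases e <;> simp only [Edge.tgt, Edge.size, Vertex.height] <;> omega

/-- The vertices of the defect line with height in `Y`. -/
def lineVertices (Y : Finset ℤ) : Finset Vertex :=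
  Y.biUnion fun y => {.left 0 y, .mid y, .right 0 y}

theorem mem_lineVertices {Y : Finset ℤ} {v : Vertex} :
    v ∈ lineVertices Y ↔ ¬ v.IsBulk ∧ v.height ∈ Y := by
  cases v <;> simp [lineVertices, Vertex.IsBulk, Vertex.height, and_comm]

theorem prod_lineVertices {A : Type*} [CommMonoid A] (Y : Finset ℤ) (F : Vertex → A) :
    ∏ v ∈ lineVertices Y, F v = ∏ y ∈ Y, F (.left 0 y) * F (.mid y) * F (.right 0 y) := by
  rw [lineVertices, Finset.prod_biUnion]
  · refine Finset.prod_congr rfl fun y _ => ?_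
    rw [Finset.prod_insert (by simp), Finset.prod_insert (by simp), Finset.prod_singleton,
      mul_assoc]
  · intro y _ z _ hyz
    simp [Function.onFun, hyz.symm]

/-- The vertex configuration with constant value `g.1`, `g.2.1`, `g.2.2` on the left lattice, the
middle line and the right lattice.  Its differential is trivial. -/
def layer {G : Type*} (g : G × G × G) : Vertex → G
  | .left _ _ => g.1
  | .mid _ => g.2.1
  | .right _ _ => g.2.2

theorem layer_src {G : Type*} (g : G × G × G) (e : Edge) : layer g e.src = layer g e.tgt := by
  cases e <;> rfl

section

variable {G : Type u} [CommGroup G]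

theorem prod_gaugeTransform_apply (V : Finset Vertex) (γ : Vertex → G) {e : Edge}
    (h1 : e.src ∈ V) (h2 : e.tgt ∈ V) :
    (∏ v ∈ V, gaugeTransform v (γ v) 1) e = γ e.src * (γ e.tgt)⁻¹ := by
  rw [Finset.prod_apply]
  simp only [gaugeTransform, Pi.one_apply, mul_one, Finset.prod_mul_distrib]
  rw [Finset.prod_ite_eq, Finset.prod_ite_eq, if_pos h1, if_pos h2]

/-- The total flux in the left lattice enters the defect line along its left column. -/
theorem prod_holonomy_left (h : Edge → G) {N : ℕ} (hh : ∀ e : Edge, N ≤ e.size + 1 → h e = 1) :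
    ∏ n ∈ Finset.range N, ∏ y ∈ Finset.Ico (-N : ℤ) N, holonomy h (.left n y) =
      ∏ y ∈ Finset.Ico (-N : ℤ) N, h (.leftV 0 y) := by
  have e (n : ℕ) (y : ℤ) : holonomy h (.left n y) = h (.leftH n y) / h (.leftH n (y + 1)) *
      (h (.leftV n y) / h (.leftV (n + 1) y)) := by
    simp only [holonomy, div_eq_mul_inv]
    ac_rfl
  have hz (n : ℕ) : ∏ y ∈ Finset.Ico (-N : ℤ) N, h (.leftH n y) / h (.leftH n (y + 1)) = 1 := by
    rw [prod_Ico_div_succ (fun y => h (.leftH n y)) (by omega),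
      hh _ (by simp only [Edge.size]; omega), hh _ (by simp only [Edge.size]; omega), div_one]
  simp only [e, Finset.prod_mul_distrib, hz, one_mul]
  rw [Finset.prod_comm]
  refine Finset.prod_congr rfl fun y _ => ?_
  rw [Finset.prod_range_div' (fun n => h (.leftV n y)), hh (.leftV N y)
    (by simp only [Edge.size]; omega), div_one]

/-- The total flux in the right lattice leaves the defect line along its right column. -/
theorem prod_holonomy_right (h : Edge → G) {N : ℕ} (hh : ∀ e : Edge, N ≤ e.size + 1 → h e = 1) :
    ∏ n ∈ Finset.range N, ∏ y ∈ Finset.Ico (-N : ℤ) N, holonomy h (.right n y) =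
      (∏ y ∈ Finset.Ico (-N : ℤ) N, h (.rightV 0 y))⁻¹ := by
  have e (n : ℕ) (y : ℤ) : holonomy h (.right n y) = h (.rightH n y) / h (.rightH n (y + 1)) *
      (h (.rightV (n + 1) y) / h (.rightV n y)) := by
    simp only [holonomy, div_eq_mul_inv]
    ac_rfl
  have hz (n : ℕ) : ∏ y ∈ Finset.Ico (-N : ℤ) N, h (.rightH n y) / h (.rightH n (y + 1)) = 1 := by
    rw [prod_Ico_div_succ (fun y => h (.rightH n y)) (by omega),
      hh _ (by simp only [Edge.size]; omega), hh _ (by simp only [Edge.size]; omega), div_one]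
  simp only [e, Finset.prod_mul_distrib, hz, one_mul]
  rw [Finset.prod_comm, ← Finset.prod_inv_distrib]
  refine Finset.prod_congr rfl fun y _ => ?_
  rw [Finset.prod_range_div (fun n => h (.rightV n y)), hh (.rightV N y)
    (by simp only [Edge.size]; omega), one_div]

theorem prod_lineEdge (h : Edge → G) (Y : Finset ℤ) :
    ∏ y ∈ Y, lineEdge h y =
      (∏ y ∈ Y, h (.leftV 0 y), ∏ y ∈ Y, h (.midV y), ∏ y ∈ Y, h (.rightV 0 y)) := by
  refine Prod.ext ?_ (Prod.ext ?_ ?_) <;> simp [lineEdge, Prod.fst_prod, Prod.snd_prod]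

/-- Conservation laws.  If a Pauli operator with finite support creates `α` on the left and `β⁻¹` on
the right, then the product of all flux constraints says that the total configuration of its shift
along the defect line is `(α.1, b, β.1)` for some `b`, and the product of all charge constraints
evaluates the commutator of `ν` on it. -/
theorem exists_of_pairCreates {ν : G × G × G →* G × G × G →* Circle} {s t : ℕ × ℤ} {α β : Anyon G}
    {x : (Edge → G) × ((Edge → G) →* Circle)} (hx : IsLocalPair x)
    (h : PairCreates ν x
      (Pi.mulSingle (Vertex.left (s.1 + 1) s.2) α.2 *
        Pi.mulSingle (Vertex.right (t.1 + 1) t.2) (β⁻¹).2)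
      (Pi.mulSingle (Plaquette.left s.1 s.2) α.1 *
        Pi.mulSingle (Plaquette.right (t.1 + 1) t.2) (β⁻¹).1)) :
    ∃ b : G, ∀ g : G × G × G,
      ν (α.1, b, β.1) g / ν g (α.1, b, β.1) = α.2 g.1 / β.2 g.2.2 := by
  classical
  obtain ⟨S, hS, hκ⟩ := hx
  obtain ⟨hc, hf, hw⟩ := h
  -- All edges of `S` and both sites lie well inside the box of size `N`.
  let N : ℕ := S.sup Edge.size + s.1 + s.2.natAbs + t.1 + t.2.natAbs + 3
  let Y : Finset ℤ := Finset.Ico (-N : ℤ) N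
  have hNS {e : Edge} (he : e ∈ S) : e.size + 3 ≤ N := by
    have := Finset.le_sup (f := Edge.size) he
    omega
  have hh (e : Edge) (he : N ≤ e.size + 1) : x.1 e = 1 := hS e fun h => by
    have := hNS h
    omega
  have hline (y : ℤ) (hy : (N : ℤ) ≤ y.natAbs + 1) : lineEdge x.1 y = 1 := by
    have h1 : x.1 (.leftV 0 y) = 1 := hh _ (by simp only [Edge.size]; omega)
    have h2 : x.1 (.midV y) = 1 := hh _ (by simp only [Edge.size]; omega)
    have h3 : x.1 (.rightV 0 y) = 1 := hh _ (by simp only [Edge.size]; omega)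
    rw [lineEdge, h1, h2, h3]
    rfl
  have hX1 : ∏ y ∈ Y, x.1 (.leftV 0 y) = α.1 := by
    rw [← prod_holonomy_left x.1 hh, Finset.prod_eq_single s.1, Finset.prod_eq_single s.2]
    · rw [hf]; simp
    · intro y _ hy
      rw [hf]; simp [hy]
    · intro hy
      exact absurd (Finset.mem_Ico.2 ⟨by omega, by omega⟩) hy
    · intro n _ hn
      refine Finset.prod_eq_one fun y _ => ?_
      rw [hf]; simp [hn]
    · intro hn
      exact absurd (Finset.mem_range.2 (by omega)) hn
  have hX3 : ∏ y ∈ Y, x.1 (.rightV 0 y) = β.1 := by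
    rw [← inv_inj, ← prod_holonomy_right x.1 hh, Finset.prod_eq_single (t.1 + 1),
      Finset.prod_eq_single t.2]
    · rw [hf]; simp
    · intro y _ hy
      rw [hf]; simp [hy]
    · intro hy
      exact absurd (Finset.mem_Ico.2 ⟨by omega, by omega⟩) hy
    · intro n _ hn
      refine Finset.prod_eq_one fun y _ => ?_
      rw [hf]; simp [hn]
    · intro hn
      exact absurd (Finset.mem_range.2 (by omega)) hn
  refine ⟨∏ y ∈ Y, x.1 (.midV y), fun g => ?_⟩
  rw [← hX1, ← hX3, ← prod_lineEdge]
  -- The constraints at the bulk vertices in `B` and at the heights in `Y` are multiplied; the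
  -- character `x.2` drops out because the product of the gauge transformations is trivial on `S`.
  let B : Finset Vertex := (S.image Edge.src ∪ S.image Edge.tgt ∪
    {.left (s.1 + 1) s.2, .right (t.1 + 1) t.2}).filter Vertex.IsBulk
  have hmem (v : Vertex) (hv : v ∈ S.image Edge.src ∪ S.image Edge.tgt) :
      v ∈ B ∪ lineVertices Y := by
    by_cases hb : v.IsBulk
    · exact Finset.mem_union_left _ (Finset.mem_filter.2 ⟨Finset.mem_union_left _ hv, hb⟩)
    · refine Finset.mem_union_right _ (mem_lineVertices.2 ⟨hb, ?_⟩)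
      have : v.height.natAbs + 2 ≤ N := by
        rcases Finset.mem_union.1 hv with hv | hv <;> obtain ⟨e, he, rfl⟩ := Finset.mem_image.1 hv
        · have := hNS he
          have := natAbs_height_src e
          omega
        · have := hNS he
          have := natAbs_height_tgt e
          omega
      exact Finset.mem_Ico.2 ⟨by omega, by omega⟩
  have hdisj : Disjoint B (lineVertices Y) := Finset.disjoint_left.2 fun v h1 h2 =>
    (mem_lineVertices.1 h2).1 (Finset.mem_filter.1 h1).2
  have htriv := hκ (∏ v ∈ B ∪ lineVertices Y, gaugeTransform v (layer g v) 1) fun e he => by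
    rw [prod_gaugeTransform_apply _ _
      (hmem _ (Finset.mem_union_left _ (Finset.mem_image_of_mem _ he)))
      (hmem _ (Finset.mem_union_right _ (Finset.mem_image_of_mem _ he))), layer_src,
      mul_inv_cancel]
  rw [map_prod, Finset.prod_union hdisj, prod_lineVertices] at htriv
  -- The shift `y ↦ y - 1` turns the two factors of the wall constraints into the commutator of `ν`.
  have hlineprod : ∏ y ∈ Y, x.2 (gaugeTransform (.left 0 y) (layer g (.left 0 y)) 1) *
      x.2 (gaugeTransform (.mid y) (layer g (.mid y)) 1) *
      x.2 (gaugeTransform (.right 0 y) (layer g (.right 0 y)) 1) =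
      ν (∏ y ∈ Y, lineEdge x.1 y) g / ν g (∏ y ∈ Y, lineEdge x.1 y) := by
    rw [← prod_Ico_sub_one (fun y => lineEdge x.1 y) (by omega) (hline _ (by omega))
      (hline _ (by omega)), map_prod, MonoidHom.finsetProd_apply,
      prod_Ico_sub_one (fun y => lineEdge x.1 y) (by omega) (hline _ (by omega))
      (hline _ (by omega)), map_prod, ← Finset.prod_div_distrib]
    refine Finset.prod_congr rfl fun y _ => ?_
    rw [hw, map_mul, map_mul]
    rfl
  have hbulkprod : ∏ v ∈ B, x.2 (gaugeTransform v (layer g v) 1) = (α.2 g.1 / β.2 g.2.2)⁻¹ := by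
    have e1 : ∏ v ∈ B, x.2 (gaugeTransform v (layer g v) 1) =
        ∏ v ∈ B, ((Pi.mulSingle (Vertex.left (s.1 + 1) s.2) (α.2 g.1) : Vertex → Circle) v *
          (Pi.mulSingle (Vertex.right (t.1 + 1) t.2) (β.2 g.2.2)⁻¹ : Vertex → Circle) v)⁻¹ := by
      refine Finset.prod_congr rfl fun v hv => ?_
      have := hc v (Finset.mem_filter.1 hv).2 (layer g v)
      rw [eq_comm, mul_comm, mul_eq_one_iff_eq_inv] at this
      rw [this]
      congr 1
      rw [Pi.mul_apply, MonoidHom.mul_apply]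
      congr 1
      · by_cases h : v = .left (s.1 + 1) s.2
        · subst h; simp [layer]
        · simp [h]
      · by_cases h : v = .right (t.1 + 1) t.2
        · subst h; simp [layer]
        · simp [h]
    rw [e1, Finset.prod_inv_distrib, Finset.prod_mul_distrib, Finset.prod_pi_mulSingle',
      Finset.prod_pi_mulSingle', if_pos, if_pos, div_eq_mul_inv]
    · exact Finset.mem_filter.2 ⟨by simp, by simp [Vertex.IsBulk]⟩
    · exact Finset.mem_filter.2 ⟨by simp, by simp [Vertex.IsBulk]⟩
  rw [hlineprod, hbulkprod, inv_mul_eq_one] at htriv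
  exact htriv.symm

end

/-! ### String operators through the wall -/

/-- A finitely supported sequence with trivial product has a finitely supported antiderivative. -/
theorem exists_div_sub_one_eq {A : Type*} [CommGroup A] (F : ℤ → A) {M N : ℤ}
    (hF : ∀ y ∉ Finset.Ico M N, F y = 1) (hprod : ∏ y ∈ Finset.Ico M N, F y = 1) :
    ∃ w : ℤ → A, (∀ y ∉ Finset.Ico M N, w y = 1) ∧ ∀ y, w y / w (y - 1) = F y := by
  refine ⟨fun y => ∏ z ∈ Finset.Ico M (y + 1), F z, fun y hy => ?_, fun y => ?_⟩
  · rcases lt_or_ge y M with h | h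
    · exact Finset.prod_eq_one fun z hz => by
        rw [Finset.mem_Ico] at hz
        omega
    · rw [Finset.mem_Ico, not_and, not_lt] at hy
      rw [← hprod]
      refine (Finset.prod_subset (Finset.Ico_subset_Ico_right ((hy h).trans (by omega)))
        fun z _ hz => hF z hz).symm
  · simp only [sub_add_cancel]
    rcases lt_or_ge y M with h | h
    · rw [hF y (by rw [Finset.mem_Ico]; omega), Finset.prod_eq_one, Finset.prod_eq_one, div_one]
      all_goals
        intro z hz
        rw [Finset.mem_Ico] at hz
        omega
    · rw [div_eq_iff_eq_mul, show Finset.Ico M (y + 1) = insert y (Finset.Ico M y) by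
        ext z; simp only [Finset.mem_Ico, Finset.mem_insert]; omega, Finset.prod_insert (by simp)]

section

variable {G : Type u} [CommGroup G]

/-- A finitely supported family of characters on the edges, as a character of the group of edge
configurations. -/
theorem exists_character_mulSingle {ζ : Edge → (G →* Circle)} {S : Finset Edge}
    (hζ : ∀ e ∉ S, ζ e = 1) :
    ∃ κ : (Edge → G) →* Circle, (∀ a : Edge → G, (∀ e ∈ S, a e = 1) → κ a = 1) ∧
      ∀ e g, κ (Pi.mulSingle e g) = ζ e g := by
  refine ⟨∏ e ∈ S, (ζ e).comp (Pi.evalMonoidHom _ e), fun a ha => ?_, fun e g => ?_⟩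
  · rw [MonoidHom.finsetProd_apply]
    exact Finset.prod_eq_one fun e he => by simp [ha e he]
  · rw [MonoidHom.finsetProd_apply]
    by_cases he : e ∈ S
    · rw [Finset.prod_eq_single e (fun e' _ h => by simp [h]) fun h => (h he).elim]
      simp
    · rw [hζ e he, Finset.prod_eq_one fun e' he' => ?_]
      · rfl
      · have : e' ≠ e := by rintro rfl; exact he he'
        simp [this]

theorem gaugeTransform_left_zero (y : ℤ) (g : G) :
    gaugeTransform (.left 0 y) g 1 = Pi.mulSingle (.leftV 0 y) g /
      (Pi.mulSingle (.leftV 0 (y - 1)) g * Pi.mulSingle (.leftH 0 y) g) := by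
  funext e
  cases e <;> simp [gaugeTransform, Edge.src, Edge.tgt, Pi.mulSingle_apply]
  all_goals split_ifs <;> first | (simp; done) | omega

theorem gaugeTransform_left_succ (n : ℕ) (y : ℤ) (g : G) :
    gaugeTransform (.left (n + 1) y) g 1 = Pi.mulSingle (.leftV (n + 1) y) g *
      Pi.mulSingle (.leftH n y) g / (Pi.mulSingle (.leftV (n + 1) (y - 1)) g *
        Pi.mulSingle (.leftH (n + 1) y) g) := by
  funext e
  cases e <;> simp [gaugeTransform, Edge.src, Edge.tgt, Pi.mulSingle_apply]
  all_goals split_ifs <;> first | (simp; done) | omega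

theorem gaugeTransform_mid (y : ℤ) (g : G) :
    gaugeTransform (.mid y) g 1 = Pi.mulSingle (.midV y) g / Pi.mulSingle (.midV (y - 1)) g := by
  funext e
  cases e <;> simp [gaugeTransform, Edge.src, Edge.tgt, Pi.mulSingle_apply]
  all_goals split_ifs <;> first | (simp; done) | omega

theorem gaugeTransform_right_zero (y : ℤ) (g : G) :
    gaugeTransform (.right 0 y) g 1 = Pi.mulSingle (.rightV 0 y) g *
      Pi.mulSingle (.rightH 0 y) g / Pi.mulSingle (.rightV 0 (y - 1)) g := by
  funext e
  cases e <;> simp [gaugeTransform, Edge.src, Edge.tgt, Pi.mulSingle_apply]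
  all_goals split_ifs <;> first | (simp; done) | omega

theorem gaugeTransform_right_succ (n : ℕ) (y : ℤ) (g : G) :
    gaugeTransform (.right (n + 1) y) g 1 = Pi.mulSingle (.rightV (n + 1) y) g *
      Pi.mulSingle (.rightH (n + 1) y) g / (Pi.mulSingle (.rightV (n + 1) (y - 1)) g *
        Pi.mulSingle (.rightH n y) g) := by
  funext e
  cases e <;> simp [gaugeTransform, Edge.src, Edge.tgt, Pi.mulSingle_apply]
  all_goals split_ifs <;> first | (simp; done) | omega

/-- The flux part of the string operator: straight strings of vertical edges from the sites to the
wall, and the flux `b` on one edge of the middle line. -/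
def fluxString (s t : ℕ × ℤ) (m b m' : G) : Edge → G
  | .leftH _ _ => 1
  | .leftV n y => if y = s.2 ∧ n ≤ s.1 then m else 1
  | .midV y => if y = 0 then b else 1
  | .rightH _ _ => 1
  | .rightV n y => if y = t.2 ∧ n ≤ t.1 + 1 then m' else 1

/-- The charge part of the string operator: straight strings of horizontal edges from the sites to
the wall, and the characters `w y` of `G × G × G` on the edges of the defect line. -/
noncomputable def chargeString (s t : ℕ × ℤ) (χ χ' : G →* Circle)
    (w : ℤ → (G × G × G →* Circle)) : Edge → (G →* Circle)
  | .leftH n y => if y = s.2 ∧ n ≤ s.1 then χ⁻¹ else 1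
  | .leftV n y => if n = 0 then (w y).comp (MonoidHom.inl G (G × G)) else 1
  | .midV y => (w y).comp ((MonoidHom.inr G (G × G)).comp (MonoidHom.inl G G))
  | .rightH n y => if y = t.2 ∧ n ≤ t.1 then χ'⁻¹ else 1
  | .rightV n y => if n = 0 then (w y).comp ((MonoidHom.inr G (G × G)).comp (MonoidHom.inr G G))
      else 1

theorem holonomy_fluxString (s t : ℕ × ℤ) (m b m' : G) (p : Plaquette) :
    holonomy (fluxString s t m b m') p = (Pi.mulSingle (Plaquette.left s.1 s.2) m *
        Pi.mulSingle (Plaquette.right (t.1 + 1) t.2) m'⁻¹ : Plaquette → G) p := by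
  cases p with
  | left n y =>
    simp only [holonomy, fluxString, Pi.mul_apply, Pi.mulSingle_apply, Plaquette.left.injEq,
      reduceCtorEq, if_false]
    by_cases hy : y = s.2
    · rcases lt_trichotomy n s.1 with h | h | h
      · simp [hy, h.le, h.ne, Nat.succ_le_of_lt h]
      · simp [hy, h]
      · simp [hy, h.not_ge, h.ne', show ¬ n + 1 ≤ s.1 by omega]
    · simp [hy]
  | right n y =>
    simp only [holonomy, fluxString, Pi.mul_apply, Pi.mulSingle_apply, Plaquette.right.injEq,
      reduceCtorEq, if_false]
    by_cases hy : y = t.2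
    · rcases lt_trichotomy n (t.1 + 1) with h | h | h
      · simp [hy, h.le, h.ne, show n ≤ t.1 by omega]
      · simp [hy, h]
      · simp [hy, h.not_ge, h.ne', show ¬ n ≤ t.1 by omega]
    · simp [hy]

/-- The converse of `exists_of_pairCreates`.  The fluxes of `fluxString` cross the defect line,
where they deposit charges; together with those brought by the horizontal strings they have trivial
product, so that strings along the defect line can cancel them. -/
theorem exists_pairCreates {ν : G × G × G →* G × G × G →* Circle} (s t : ℕ × ℤ) {α β : Anyon G}
    {b : G} (hb : ∀ g : G × G × G,
      ν (α.1, b, β.1) g / ν g (α.1, b, β.1) = α.2 g.1 / β.2 g.2.2) :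
    ∃ x, IsLocalPair x ∧ PairCreates ν x
      (Pi.mulSingle (Vertex.left (s.1 + 1) s.2) α.2 *
        Pi.mulSingle (Vertex.right (t.1 + 1) t.2) (β⁻¹).2)
      (Pi.mulSingle (Plaquette.left s.1 s.2) α.1 *
        Pi.mulSingle (Plaquette.right (t.1 + 1) t.2) (β⁻¹).1) := by
  classical
  obtain ⟨m, χ⟩ := α
  obtain ⟨m', χ'⟩ := β
  simp only [Prod.snd_inv, Prod.fst_inv] at hb ⊢
  let h := fluxString s t m b m'
  let N : ℕ := s.2.natAbs + t.2.natAbs + 2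
  let Y : Finset ℤ := Finset.Ico (-N : ℤ) N
  have hline (y : ℤ) (hy : (N : ℤ) ≤ y.natAbs + 1) : lineEdge h y = 1 := by
    have h1 : y ≠ s.2 := by omega
    have h2 : y ≠ 0 := by omega
    have h3 : y ≠ t.2 := by omega
    simp [lineEdge, h, fluxString, h1, h2, h3]
  have hX : ∏ y ∈ Y, lineEdge h y = (m, b, m') := by
    have hs : s.2 ∈ Y := Finset.mem_Ico.2 ⟨by omega, by omega⟩
    have h0 : (0 : ℤ) ∈ Y := Finset.mem_Ico.2 ⟨by omega, by omega⟩
    have ht : t.2 ∈ Y := Finset.mem_Ico.2 ⟨by omega, by omega⟩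
    rw [prod_lineEdge]
    simp [h, fluxString, Finset.prod_ite_eq', hs, h0, ht]
  -- The charges which the fluxes `h` deposit on the defect line, less those absorbed by the
  -- horizontal strings.
  let F : ℤ → (G × G × G →* Circle) := fun y =>
    (ν (lineEdge h (y - 1)) / ν.flip (lineEdge h y)) /
      ((if y = s.2 then χ.comp (MonoidHom.fst G (G × G)) else 1) /
        (if y = t.2 then χ'.comp ((MonoidHom.snd G G).comp (MonoidHom.snd G (G × G))) else 1))
  have hF (y : ℤ) (hy : y ∉ Y) : F y = 1 := by
    rw [Finset.mem_Ico] at hy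
    have h1 : y ≠ s.2 := by omega
    have h3 : y ≠ t.2 := by omega
    simp [F, h1, h3, hline y (by omega), hline (y - 1) (by omega)]
  have hFprod : ∏ y ∈ Y, F y = 1 := by
    have hs : s.2 ∈ Y := Finset.mem_Ico.2 ⟨by omega, by omega⟩
    have ht : t.2 ∈ Y := Finset.mem_Ico.2 ⟨by omega, by omega⟩
    simp only [F, Finset.prod_div_distrib]
    rw [← map_prod, ← map_prod, prod_Ico_sub_one (fun y => lineEdge h y) (by omega)
      (hline _ (by omega)) (hline _ (by omega)), Finset.prod_ite_eq', Finset.prod_ite_eq',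
      if_pos hs, if_pos ht]
    change ν (∏ y ∈ Y, lineEdge h y) / ν.flip (∏ y ∈ Y, lineEdge h y) / _ = 1
    rw [hX, div_eq_one]
    exact MonoidHom.ext hb
  obtain ⟨w, hw, hwF⟩ := exists_div_sub_one_eq F hF hFprod
  let S : Finset Edge := (Finset.range (s.1 + 1)).image (Edge.leftH · s.2) ∪
    (Finset.range (t.1 + 1)).image (Edge.rightH · t.2) ∪
    (Y.image (Edge.leftV 0) ∪ Y.image Edge.midV ∪ Y.image (Edge.rightV 0))
  have hζ (e : Edge) (he : e ∉ S) : chargeString s t χ χ' w e = 1 := by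
    simp only [S, Finset.mem_union, not_or, Finset.mem_image, not_exists, not_and] at he
    obtain ⟨⟨h1, h2⟩, ⟨h3, h4⟩, h5⟩ := he
    cases e with
    | leftH n y =>
      refine if_neg fun hh => h1 n (Finset.mem_range.2 (Nat.lt_succ_of_le hh.2)) ?_
      rw [hh.1]
    | rightH n y =>
      refine if_neg fun hh => h2 n (Finset.mem_range.2 (Nat.lt_succ_of_le hh.2)) ?_
      rw [hh.1]
    | leftV n y =>
      by_cases hn : n = 0
      · subst hn
        simp only [chargeString, if_true, hw y fun hy => h3 y hy rfl, MonoidHom.one_comp]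
      · exact if_neg hn
    | midV y => simp only [chargeString, hw y fun hy => h4 y hy rfl, MonoidHom.one_comp]
    | rightV n y =>
      by_cases hn : n = 0
      · subst hn
        simp only [chargeString, if_true, hw y fun hy => h5 y hy rfl, MonoidHom.one_comp]
      · exact if_neg hn
  obtain ⟨κ, hκS, hκ⟩ := exists_character_mulSingle hζ
  let T : Finset Edge := (Finset.range (s.1 + 1)).image (Edge.leftV · s.2) ∪ {Edge.midV 0} ∪
    (Finset.range (t.1 + 2)).image (Edge.rightV · t.2)
  have hh (e : Edge) (he : e ∉ T) : h e = 1 := by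
    simp only [T, Finset.mem_union, not_or, Finset.mem_image, not_exists, not_and,
      Finset.mem_singleton] at he
    obtain ⟨⟨h1, h2⟩, h3⟩ := he
    cases e with
    | leftH n y => rfl
    | rightH n y => rfl
    | leftV n y =>
      refine if_neg fun hh => h1 n (Finset.mem_range.2 (Nat.lt_succ_of_le hh.2)) ?_
      rw [hh.1]
    | midV y => exact if_neg fun hh => h2 (by rw [hh])
    | rightV n y =>
      refine if_neg fun hh => h3 n (Finset.mem_range.2 (Nat.lt_succ_of_le hh.2)) ?_
      rw [hh.1]
  refine ⟨(h, κ), ⟨T ∪ S, fun e he => hh e fun h => he (Finset.mem_union_left _ h),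
    fun a ha => hκS a fun e he => ha e (Finset.mem_union_right _ he)⟩, fun v hv g => ?_,
    fun p => holonomy_fluxString s t m b m' p, fun y g => ?_⟩
  · cases v with
    | mid y => exact hv.elim
    | left n y =>
      obtain ⟨n, rfl⟩ := Nat.exists_eq_succ_of_ne_zero hv
      rw [Nat.succ_eq_add_one, gaugeTransform_left_succ]
      simp only [map_div, map_mul, hκ, chargeString, Nat.add_eq_zero_iff, one_ne_zero, and_false,
        if_false, MonoidHom.one_apply, one_mul, Pi.mul_apply, Pi.mulSingle_apply, reduceCtorEq,
        Vertex.left.injEq, mul_one, add_left_inj]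
      by_cases hy : y = s.2
      · rcases lt_trichotomy n s.1 with h | h | h
        · simp [hy, h.le, h.ne, Nat.succ_le_of_lt h]
        · simp [hy, h]
        · simp [hy, h.not_ge, h.ne', show ¬ n + 1 ≤ s.1 by omega]
      · simp [hy]
    | right n y =>
      obtain ⟨n, rfl⟩ := Nat.exists_eq_succ_of_ne_zero hv
      rw [Nat.succ_eq_add_one, gaugeTransform_right_succ]
      simp only [map_div, map_mul, hκ, chargeString, Nat.add_eq_zero_iff, one_ne_zero, and_false,
        if_false, MonoidHom.one_apply, one_mul, Pi.mul_apply, Pi.mulSingle_apply, reduceCtorEq,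
        Vertex.right.injEq, add_left_inj]
      by_cases hy : y = t.2
      · rcases lt_trichotomy n t.1 with h | h | h
        · simp [hy, h.le, h.ne, Nat.succ_le_of_lt h]
        · simp [hy, h]
        · simp [hy, h.not_ge, h.ne', show ¬ n + 1 ≤ t.1 by omega]
      · simp [hy]
  · have key : ν (lineEdge h (y - 1)) g / ν g (lineEdge h y) = w y g / w (y - 1) g *
        ((if y = s.2 then χ g.1 else 1) / (if y = t.2 then χ' g.2.2 else 1)) := by
      have := DFunLike.congr_fun (hwF y) g
      simp only [F, MonoidHom.div_apply, MonoidHom.flip_apply] at this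
      rw [this]
      split_ifs <;> simp
    have hwg (z : ℤ) : w z g = w z (g.1, 1) * w z (1, g.2.1, 1) * w z (1, 1, g.2.2) := by
      rw [← map_mul, ← map_mul]
      simp
    change ν (lineEdge h (y - 1)) g / ν g (lineEdge h y) = _
    rw [key, gaugeTransform_left_zero, gaugeTransform_mid, gaugeTransform_right_zero, hwg, hwg]
    simp only [map_div, map_mul, hκ, chargeString, Nat.zero_le, and_true, if_true,
      MonoidHom.comp_apply, MonoidHom.inl_apply, MonoidHom.inr_apply]
    have e1 : (if y = s.2 then χ⁻¹ else 1) g.1 = (if y = s.2 then χ g.1 else 1)⁻¹ := by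
      split_ifs <;> simp
    have e2 : (if y = t.2 then χ'⁻¹ else 1) g.2.2 = (if y = t.2 then χ' g.2.2 else 1)⁻¹ := by
      split_ifs <;> simp
    rw [e1, e2]
    apply Additive.ofMul.injective
    simp only [ofMul_mul, ofMul_div, ofMul_inv]
    abel

/-! ### The sewn wall -/

/-- For a bicharacter `ν` with commutator `Ω = ν / νᵀ`, the flux `m` and charge `χ` pass through the
sewn wall as `m'` and `χ'` exactly if, for some flux `b` on the middle line, the character
`Ω (m, b, m')` of `G × G × G` is `χ ⊗ 1 ⊗ χ'⁻¹`. -/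
theorem passes_bicharacter_iff [Finite G] (ν : G × G × G →* G × G × G →* Circle) (s t : ℕ × ℤ)
    (α β : Anyon G) :
    Passes (fun x y => ν x y) s t α β ↔ ∃ b : G, ∀ g : G × G × G,
      ν (α.1, b, β.1) g / ν g (α.1, b, β.1) = α.2 g.1 / β.2 g.2.2 := by
  constructor
  · rintro ⟨O, hO, hu, h⟩
    have : Nontrivial (Module.End ℂ (State Edge G)) := by
      refine ⟨1, 0, fun h => ?_⟩
      have := DFunLike.congr_fun (LinearMap.congr_fun h (Finsupp.single 1 1)) 1
      simp at this
    obtain ⟨x, hx, hc⟩ := exists_pairCreates_of_creates hO hu.ne_zero h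
    exact exists_of_pairCreates hx hc
  · rintro ⟨b, hb⟩
    obtain ⟨x, hx, hc⟩ := exists_pairCreates s t hb
    exact ⟨pauli x, pauli_mem_localAlgebra hx, isUnit_pauli x, creates_pauli hc⟩

/-- Every braided autoequivalence is realized by a sewn wall. -/
theorem exists_cocycle_of_isBraidedAutoequivalence [Finite G] {φ : Anyon G ≃* Anyon G}
    (hφ : IsBraidedAutoequivalence φ) :
    ∃ ν : G × G × G → G × G × G → Circle, IsTwoCocycle ν ∧
      ∀ (s t : ℕ × ℤ) (α β : Anyon G), Passes ν s t α β ↔ β = φ α := by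
  obtain ⟨ν, hν⟩ := exists_bicharacter_of_isBraidedAutoequivalence hφ
  exact ⟨fun x y => ν x y, isTwoCocycle_bicharacter ν, fun s t α β =>
    (passes_bicharacter_iff ν s t α β).trans (hν α β)⟩

end

end SPTSewing

theorem theorem1 {G : Type*} [CommGroup G] [Finite G] :
    (∀ W : Subgroup (SPTSewing.Anyon G × SPTSewing.Anyon G),
      SPTSewing.IsGappedWall W → SPTSewing.IsInvertibleWall W →
      ∃ ν : G × G × G → G × G × G → Circle, SPTSewing.IsTwoCocycle ν ∧
        ∀ (s t : ℕ × ℤ) (α β : SPTSewing.Anyon G),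
          SPTSewing.Passes ν s t α β ↔ (α, β) ∈ W) ∧
    (∀ φ : SPTSewing.Anyon G ≃* SPTSewing.Anyon G, SPTSewing.IsBraidedAutoequivalence φ →
      ∃ ν : G × G × G → G × G × G → Circle, SPTSewing.IsTwoCocycle ν ∧
        ∀ (s t : ℕ × ℤ) (α β : SPTSewing.Anyon G),
          SPTSewing.Passes ν s t α β ↔ β = φ α) := by
  refine ⟨fun W hW hI => ?_, fun φ hφ => SPTSewing.exists_cocycle_of_isBraidedAutoequivalence hφ⟩
  obtain ⟨φ, hφ, hgraph⟩ := SPTSewing.exists_braidedAutoequivalence_of_wall hW hI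
  obtain ⟨ν, hν, hpass⟩ := SPTSewing.exists_cocycle_of_isBraidedAutoequivalence hφ
  exact ⟨ν, hν, fun s t α β => (hpass s t α β).trans (hgraph α β).symm⟩
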